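/- Let $\mathcal H$ be a finite-dimensional complex Hilbert space and let $\mathcal M$ be an arbitrary (finite or infinite) set of density operators (positive semidefinite operators of trace one) on $\mathcal H$. All auxiliary Hilbert spaces below are finite-dimensional, of unspecified dimension; a pure state is a projector $|\varphi\rangle\langle\varphi|$ onto a unit vector; CPTP means linear, completely positive and trace preserving; the trace distance of two operators is $\|\rho-\sigma\|=\tfrac12\operatorname{tr}|\rho-\sigma|$ with $|A|=\sqrt{A^\dagger A}$. Two density operators are called orthogonal if $\rho\tau=0$. A set $\mathcal S$ of density operators on $\mathcal H$ is called essentially pure if there are spaces $\mathcal H_{\mathrm{aux}},\mathcal H_A,\mathcal H_B$, density operators $\omega_{\mathrm{aux}}$ on $\mathcal H_{\mathrm{aux}}$ and $\sigma_B$ on $\mathcal H_B$, and a unitary $U:\mathcal H_A\otimes\mathcal H_B\to\mathcal H\otimes\mathcal H_{\mathrm{aux}}$, such that for every $\rho\in\mathcal S$ there is a pure state $|\phi_\rho\rangle\langle\phi_\rho|$ on $\mathcal H_A$ with $$\rho\otimes\omega_{\mathrm{aux}}=U\big(|\phi_\rho\rangle\langle\phi_\rho|\otimes\sigma_B\big)U^\dagger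 .$$ Then the following statements are equivalent. (i) A perfect purifier of $\mathcal M$ exists: there are an auxiliary space $\mathcal H_{\mathrm{aux}}$ and a CPTP map $\Lambda$ from operators on $\mathcal H$ to operators on $\mathcal H\otimes\mathcal H_{\mathrm{aux}}$ such that, for every $\rho\in\mathcal M$, the state $\Lambda[\rho]$ is pure and $\operatorname{tr}_{\mathrm{aux}}\Lambda[\rho]=\rho$. (ii) There are a finite-dimensional Hilbert space $\mathcal K$ and a CPTP map $\Lambda$ from operators on $\mathcal H$ to operators on $\mathcal K$ such that $\Lambda[\rho]$ is pure for every $\rho\in\mathcal M$ and $\|\Lambda[\rho]-\Lambda[\rho']\|=\|\rho-\rho'\|$ for all $\rho,\rho'\in\mathcal M$. (iii) $\mathcal M$ is an orthogonal union of essentially pure sets: $\mathcal M$ is a union of essentially pure sets (each with its own $U$, $\omega_{\mathrm{aux}}$, $\sigma_B$) such that any two states taken from different sets of the union are orthogonal. -/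

import Mathlib

open scoped Kronecker ComplexOrder

noncomputable section

namespace Purification

/-- A density operator on `ℂ^n`: a positive semidefinite matrix of trace one. -/
def IsDensity {n : Type*} [Fintype n] (ρ : Matrix n n ℂ) : Prop :=
  ρ.PosSemidef ∧ ρ.trace = 1

/-- A pure state: the rank-one projector `|φ⟩⟨φ|` of a unit vector `φ`. -/
def IsPure {n : Type*} [Fintype n] (ρ : Matrix n n ℂ) : Prop :=
  ∃ φ : n → ℂ, star φ ⬝ᵥ φ = 1 ∧ ρ = Matrix.vecMulVec φ (star φ)

/-- Complete positivity: for every `k`, the map `id_k ⊗ Λ` sends positive semidefinite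
`k × k` block matrices with blocks in `M_n(ℂ)` to positive semidefinite block matrices. -/
def IsCompletelyPositive {n m : Type*} [Fintype n] [Fintype m]
    (Λ : Matrix n n ℂ →ₗ[ℂ] Matrix m m ℂ) : Prop :=
  ∀ (k : ℕ) (X : Matrix (Fin k) (Fin k) (Matrix n n ℂ)),
    (Matrix.comp (Fin k) (Fin k) n n ℂ X).PosSemidef →
      (Matrix.comp (Fin k) (Fin k) m m ℂ (X.map Λ)).PosSemidef

/-- Completely positive and trace preserving linear maps. -/
structure IsCPTP {n m : Type*} [Fintype n] [Fintype m]
    (Λ : Matrix n n ℂ →ₗ[ℂ] Matrix m m ℂ) : Prop where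
  completelyPositive : IsCompletelyPositive Λ
  tracePreserving : ∀ X, (Λ X).trace = X.trace

/-- Partial trace over the second tensor factor. -/
def partialTrace {n r : Type*} [Fintype r] (X : Matrix (n × r) (n × r) ℂ) : Matrix n n ℂ :=
  Matrix.of fun i j => ∑ a, X (i, a) (j, a)

/-- Trace distance `½ tr |ρ - σ|`, where `|A| = √(A† A)`. -/
def traceDist {n : Type*} [Fintype n] [DecidableEq n] (ρ σ : Matrix n n ℂ) : ℝ :=
  (1 / 2 : ℝ) * (cfc Real.sqrt ((ρ - σ).conjTranspose * (ρ - σ))).trace.re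

/-- `Λ` is a perfect purifier of `M`: a CPTP map from operators on `H` to operators on
`H ⊗ H_aux` whose output on every state of `M` is pure and faithful. -/
structure IsPerfectPurifier {n r : Type*} [Fintype n] [Fintype r]
    (M : Set (Matrix n n ℂ)) (Λ : Matrix n n ℂ →ₗ[ℂ] Matrix (n × r) (n × r) ℂ) : Prop where
  cptp : IsCPTP Λ
  pure : ∀ ρ ∈ M, IsPure (Λ ρ)
  faithful : ∀ ρ ∈ M, partialTrace (Λ ρ) = ρ

/-- `S` is essentially pure: `ρ ⊗ ω = U (Φ_ρ ⊗ σ) U†` for all `ρ ∈ S`, with `Φ_ρ` pure and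
with common states `ω`, `σ` and a common unitary `U`. The matrix `U` identifies the two
splits `H ⊗ aux` and `A ⊗ B` of the composite system, hence its rectangular index types;
the two equations force both sides to have the same dimension. -/
def IsEssentiallyPure {n : Type*} [Fintype n] [DecidableEq n] (S : Set (Matrix n n ℂ)) : Prop :=
  ∃ (r a b : ℕ) (ω : Matrix (Fin r) (Fin r) ℂ) (σ : Matrix (Fin b) (Fin b) ℂ)
    (U : Matrix (n × Fin r) (Fin a × Fin b) ℂ),
    IsDensity ω ∧ IsDensity σ ∧
    U * U.conjTranspose = 1 ∧ U.conjTranspose * U = 1 ∧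
    ∀ ρ ∈ S, ∃ Φ : Matrix (Fin a) (Fin a) ℂ,
      IsPure Φ ∧ ρ ⊗ₖ ω = U * (Φ ⊗ₖ σ) * U.conjTranspose

/-- `M` is an orthogonal union of essentially pure sets: a union of essentially pure sets such
that any two states taken from different sets are orthogonal. -/
def IsOrthogonalUnionOfEssentiallyPure {n : Type*} [Fintype n] [DecidableEq n]
    (M : Set (Matrix n n ℂ)) : Prop :=
  ∃ C : Set (Set (Matrix n n ℂ)), M = ⋃₀ C ∧
    (∀ S ∈ C, IsEssentiallyPure S) ∧
    ∀ S ∈ C, ∀ T ∈ C, S ≠ T → ∀ ρ ∈ S, ∀ τ ∈ T, ρ * τ = 0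

end Purification

end

open scoped Kronecker ComplexOrder

noncomputable section

set_option linter.unusedSectionVars false

namespace Purification

open Matrix

variable {n m l r : Type*} [Fintype n] [Fintype m] [Fintype l] [Fintype r]

/-! (i) → (ii): discarding the auxiliary system inverts a perfect purifier on `M`, and channels
never increase the trace norm (`IsCPTP.traceNorm_le`), so neither direction can lose distance.

(iii) → (i): on an essentially pure set, adjoining `ω`, undoing `U` and discarding `σ` extracts the
pure state. Attaching a purification of `σ` and reapplying `U` purifies `ρ ⊗ ω`, hence `ρ`.
Orthogonal pieces are told apart by a projective measurement, and only finitely many nonempty ones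
fit in finite dimension.

(ii) → (iii): dilate the channel to an isometry `V`. As the output is pure, `V ρ V†` is a product
`Φ_ρ ⊗ σ_ρ`; group the states by `σ_ρ`. Inside a group, extending `V` to a unitary gives essential
purity. The crux is `mul_eq_zero_of_traceNorm_eq`, for states of different groups. If `S` is the
sign of `Φ_ρ - Φ_ρ'`, then `S ⊗ 1` attains the trace norm of `Φ_ρ ⊗ σ_ρ - Φ_ρ' ⊗ σ_ρ'` and so
commutes with it. As `σ_ρ ≠ σ_ρ'`, `S` commutes with both pure states, whose vectors are therefore
eigenvectors of `S`: either orthogonal, or of equal eigenvalue, which makes the distance zero. -/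

/-! ### Trace norm and its variational characterisation -/

/-- The trace norm `tr |X|`. -/
def traceNorm [DecidableEq n] (X : Matrix n n ℂ) : ℝ :=
  (cfc Real.sqrt (X.conjTranspose * X)).trace.re

theorem traceDist_eq [DecidableEq n] (ρ σ : Matrix n n ℂ) :
    traceDist ρ σ = (1 / 2 : ℝ) * traceNorm (ρ - σ) := rfl

theorem exists_eq_conjTranspose_mul_self {A : Matrix n n ℂ} (hA : A.PosSemidef) :
    ∃ B : Matrix n n ℂ, A = Bᴴ * B := by
  classical
  open scoped MatrixOrder in
  exact CStarAlgebra.nonneg_iff_eq_star_mul_self.mp hA.nonneg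

theorem trace_mul_eq_trace_mul_conjTranspose (B C : Matrix n n ℂ) :
    ((Bᴴ * B) * (Cᴴ * C)).trace = ((C * Bᴴ)ᴴ * (C * Bᴴ)).trace := by
  rw [conjTranspose_mul, conjTranspose_conjTranspose, Matrix.trace_mul_comm (Bᴴ * B)]
  simp only [Matrix.mul_assoc]
  rw [Matrix.trace_mul_comm B]
  simp only [Matrix.mul_assoc]

theorem trace_mul_nonneg {A B : Matrix n n ℂ} (hA : A.PosSemidef) (hB : B.PosSemidef) :
    0 ≤ (A * B).trace := by
  obtain ⟨A, rfl⟩ := exists_eq_conjTranspose_mul_self hA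
  obtain ⟨B, rfl⟩ := exists_eq_conjTranspose_mul_self hB
  rw [trace_mul_eq_trace_mul_conjTranspose]
  exact (posSemidef_conjTranspose_mul_self _).trace_nonneg

/-- With `A = a† a` and `B = b† b`, the trace is the squared Hilbert–Schmidt norm of `b a†`. -/
theorem mul_eq_zero_of_trace_mul_eq_zero {A B : Matrix n n ℂ} (hA : A.PosSemidef)
    (hB : B.PosSemidef) (h : (A * B).trace = 0) : A * B = 0 := by
  obtain ⟨A, rfl⟩ := exists_eq_conjTranspose_mul_self hA
  obtain ⟨B, rfl⟩ := exists_eq_conjTranspose_mul_self hB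
  rw [trace_mul_eq_trace_mul_conjTranspose, trace_conjTranspose_mul_self_eq_zero_iff] at h
  have h' : A * Bᴴ = 0 := by simpa using congrArg conjTranspose h
  rw [Matrix.mul_assoc, ← Matrix.mul_assoc A, h']
  simp

/-- Positive and negative part, and sign, of a Hermitian matrix. -/
theorem exists_jordan_decomposition [DecidableEq n] {X : Matrix n n ℂ} (hX : X.IsHermitian) :
    ∃ P N S : Matrix n n ℂ, P.PosSemidef ∧ N.PosSemidef ∧ S.IsHermitian ∧
      (1 - S).PosSemidef ∧ (1 + S).PosSemidef ∧ X = P - N ∧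
      traceNorm X = P.trace.re + N.trace.re ∧ traceNorm X = (X * S).trace.re := by
  have hsa : IsSelfAdjoint X := hX
  -- The spectrum is finite, so even the discontinuous sign function is admissible in the functional
  -- calculus.
  have hc : ∀ f : ℝ → ℝ, ContinuousOn f (spectrum ℝ X) := fun f =>
    (Matrix.finite_real_spectrum).continuousOn f
  have habs : cfc Real.sqrt (Xᴴ * X) = cfc (fun x : ℝ => |x|) X := by
    rw [hX.eq, ← pow_two, ← cfc_pow_id (R := ℝ) X 2, ← cfc_comp' Real.sqrt (fun x : ℝ => x ^ 2) X
      (Real.continuous_sqrt.continuousOn)]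
    simp only [Real.sqrt_sq_eq_abs]
  open scoped MatrixOrder in
  refine ⟨cfc (fun x : ℝ => max x 0) X, cfc (fun x : ℝ => max (-x) 0) X,
    cfc (fun x : ℝ => (SignType.sign x : ℝ)) X,
    (cfc_nonneg fun x _ => le_max_right _ _).posSemidef,
    (cfc_nonneg fun x _ => le_max_right _ _).posSemidef,
    cfc_predicate (R := ℝ) (p := IsSelfAdjoint) _ X, ?_, ?_, ?_, ?_, ?_⟩
  · rw [← cfc_const_one ℝ X, ← cfc_sub _ _ X (hc _) (hc _)]
    refine (cfc_nonneg fun x _ => ?_).posSemidef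
    rcases lt_trichotomy x 0 with h | h | h <;> simp [h]
  · rw [← cfc_const_one ℝ X, ← cfc_add X _ _ (hc _) (hc _)]
    refine (cfc_nonneg fun x _ => ?_).posSemidef
    rcases lt_trichotomy x 0 with h | h | h <;> simp [h]
  · rw [← cfc_sub _ _ X (hc _) (hc _)]
    conv_lhs => rw [← cfc_id' ℝ X]
    refine cfc_congr fun x _ => ?_
    rcases le_total x 0 with h | h <;> simp [h]
  · rw [traceNorm, habs, ← Complex.add_re, ← Matrix.trace_add, ← cfc_add X _ _ (hc _) (hc _)]
    congr 2
    refine cfc_congr fun x _ => ?_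
    rcases le_total x 0 with h | h <;> simp [h, abs_of_nonpos, abs_of_nonneg]
  · rw [traceNorm, habs]
    nth_rw 2 [← cfc_id' ℝ X]
    rw [← cfc_mul _ _ X (hc _) (hc _)]
    congr 2
    refine cfc_congr fun x _ => ?_
    simp

theorem trace_mul_re_le {P N S : Matrix n n ℂ} [DecidableEq n] (hP : P.PosSemidef)
    (hN : N.PosSemidef) (hS : (1 - S).PosSemidef) (hS' : (1 + S).PosSemidef) :
    ((P - N) * S).trace.re ≤ P.trace.re + N.trace.re := by
  have h1 := (Complex.le_def.mp (trace_mul_nonneg hP hS)).1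
  have h2 := (Complex.le_def.mp (trace_mul_nonneg hN hS')).1
  simp only [mul_sub, mul_add, mul_one, sub_mul, trace_sub, trace_add, Complex.sub_re,
    Complex.add_re, Complex.zero_re] at *
  linarith

/-- If a contraction attains the trace norm, it commutes. -/
theorem commute_of_traceNorm_le {X S : Matrix n n ℂ} [DecidableEq n] (hX : X.IsHermitian)
    (hSH : S.IsHermitian) (hS : (1 - S).PosSemidef) (hS' : (1 + S).PosSemidef)
    (h : traceNorm X ≤ (X * S).trace.re) : X * S = S * X := by
  obtain ⟨P, N, -, hP, hN, -, -, -, rfl, hPN, -⟩ := exists_jordan_decomposition hX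
  have h1 := Complex.le_def.mp (trace_mul_nonneg hP hS)
  have h2 := Complex.le_def.mp (trace_mul_nonneg hN hS')
  -- Attaining the norm leaves no slack in two nonnegative traces, so both vanish: `S` is `1` on the
  -- range of `P` and `-1` on that of `N`.
  have h3 : (P * (1 - S)).trace.re + (N * (1 + S)).trace.re ≤ 0 := by
    rw [hPN] at h
    simp only [mul_sub, mul_add, mul_one, sub_mul, trace_sub, trace_add, Complex.sub_re,
      Complex.add_re] at *
    linarith
  simp only [Complex.zero_re, Complex.zero_im] at h1 h2
  have hP0 : P * (1 - S) = 0 := mul_eq_zero_of_trace_mul_eq_zero hP hS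
    (Complex.ext (by simp only [Complex.zero_re]; linarith [h1.1, h2.1]) h1.2.symm)
  have hN0 : N * (1 + S) = 0 := mul_eq_zero_of_trace_mul_eq_zero hN hS'
    (Complex.ext (by simp only [Complex.zero_re]; linarith [h1.1, h2.1]) h2.2.symm)
  have e1 : P * S = P := by rw [mul_sub, mul_one, sub_eq_zero] at hP0; exact hP0.symm
  have e2 : N * S = -N := by
    rw [mul_add, mul_one, add_comm] at hN0; exact eq_neg_of_add_eq_zero_left hN0
  have e1' : S * P = P := by
    simpa [conjTranspose_mul, hSH.eq, hP.isHermitian.eq] using congrArg conjTranspose e1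
  have e2' : S * N = -N := by
    simpa [conjTranspose_mul, hSH.eq, hN.isHermitian.eq] using congrArg conjTranspose e2
  rw [sub_mul, mul_sub, e1, e2, e1', e2']

/-- Test the image against its own sign: the images of `P` and `N` are still positive with unchanged
traces, so `trace_mul_re_le` applies. -/
theorem traceNorm_map_le [DecidableEq n] [DecidableEq m] (Λ : Matrix n n ℂ →ₗ[ℂ] Matrix m m ℂ)
    (hpos : ∀ A, A.PosSemidef → (Λ A).PosSemidef) (htr : ∀ A, (Λ A).trace = A.trace)
    {X : Matrix n n ℂ} (hX : X.IsHermitian) : traceNorm (Λ X) ≤ traceNorm X := by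
  obtain ⟨P, N, -, hP, hN, -, -, -, rfl, hPN, -⟩ := exists_jordan_decomposition hX
  have hΛ : (Λ (P - N)).IsHermitian := by
    rw [map_sub]; exact (hpos P hP).isHermitian.sub (hpos N hN).isHermitian
  obtain ⟨-, -, S, -, -, -, hS, hS', -, -, hSt⟩ := exists_jordan_decomposition hΛ
  rw [hSt, hPN, map_sub, ← htr P, ← htr N]
  exact trace_mul_re_le (hpos P hP) (hpos N hN) hS hS'

theorem eq_zero_of_traceNorm_eq_zero [DecidableEq n] {X : Matrix n n ℂ} (hX : X.IsHermitian)
    (h : traceNorm X = 0) : X = 0 := by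
  obtain ⟨P, N, -, hP, hN, -, -, -, rfl, hPN, -⟩ := exists_jordan_decomposition hX
  have h1 := Complex.le_def.mp hP.trace_nonneg
  have h2 := Complex.le_def.mp hN.trace_nonneg
  simp only [Complex.zero_re, Complex.zero_im] at h1 h2
  rw [hP.trace_eq_zero_iff.mp (Complex.ext (by simp; linarith [h1.1, h2.1]) h1.2.symm),
    hN.trace_eq_zero_iff.mp (Complex.ext (by simp; linarith [h1.1, h2.1]) h2.2.symm), sub_zero]

/-! ### Channels: conjugation, adjoining a state, partial trace -/

theorem IsCompletelyPositive.posSemidef {Λ : Matrix n n ℂ →ₗ[ℂ] Matrix m m ℂ}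
    (h : IsCompletelyPositive Λ) {A : Matrix n n ℂ} (hA : A.PosSemidef) : (Λ A).PosSemidef :=
  (h 1 (of fun _ _ => A) (hA.submatrix Prod.snd)).submatrix fun i => (0, i)

theorem IsCPTP.traceNorm_le [DecidableEq n] [DecidableEq m]
    {Λ : Matrix n n ℂ →ₗ[ℂ] Matrix m m ℂ} (h : IsCPTP Λ) {X : Matrix n n ℂ}
    (hX : X.IsHermitian) : traceNorm (Λ X) ≤ traceNorm X :=
  traceNorm_map_le Λ (fun _ hA => h.completelyPositive.posSemidef hA) h.tracePreserving hX

theorem IsCPTP.isDensity {Λ : Matrix n n ℂ →ₗ[ℂ] Matrix m m ℂ} (h : IsCPTP Λ) {ρ : Matrix n n ℂ}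
    (hρ : IsDensity ρ) : IsDensity (Λ ρ) :=
  ⟨h.completelyPositive.posSemidef hρ.1, (h.tracePreserving ρ).trans hρ.2⟩

theorem IsCompletelyPositive.comp {Λ : Matrix n n ℂ →ₗ[ℂ] Matrix m m ℂ}
    {Γ : Matrix m m ℂ →ₗ[ℂ] Matrix l l ℂ} (hΓ : IsCompletelyPositive Γ)
    (hΛ : IsCompletelyPositive Λ) : IsCompletelyPositive (Γ ∘ₗ Λ) :=
  fun k X hX => hΓ k (X.map Λ) (hΛ k X hX)

theorem IsCompletelyPositive.add {Λ Γ : Matrix n n ℂ →ₗ[ℂ] Matrix m m ℂ}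
    (hΛ : IsCompletelyPositive Λ) (hΓ : IsCompletelyPositive Γ) :
    IsCompletelyPositive (Λ + Γ) :=
  fun k X hX => (hΛ k X hX).add (hΓ k X hX)

theorem IsCPTP.comp {Λ : Matrix n n ℂ →ₗ[ℂ] Matrix m m ℂ}
    {Γ : Matrix m m ℂ →ₗ[ℂ] Matrix l l ℂ} (hΓ : IsCPTP Γ) (hΛ : IsCPTP Λ) : IsCPTP (Γ ∘ₗ Λ) :=
  ⟨hΓ.completelyPositive.comp hΛ.completelyPositive,
    fun X => (hΓ.tracePreserving _).trans (hΛ.tracePreserving X)⟩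

/-- The map `X ↦ V X V†`. -/
def conjMap (V : Matrix m n ℂ) : Matrix n n ℂ →ₗ[ℂ] Matrix m m ℂ where
  toFun X := V * X * Vᴴ
  map_add' X Y := by rw [Matrix.mul_add, Matrix.add_mul]
  map_smul' c X := by simp

theorem conjMap_apply (V : Matrix m n ℂ) (X : Matrix n n ℂ) : conjMap V X = V * X * Vᴴ := rfl

theorem isCompletelyPositive_conjMap (V : Matrix m n ℂ) : IsCompletelyPositive (conjMap V) := by
  intro k X hX
  convert hX.mul_mul_conjTranspose_same ((1 : Matrix (Fin k) (Fin k) ℂ) ⊗ₖ V) using 1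
  ext ⟨i, p⟩ ⟨j, q⟩
  simp [Matrix.comp_apply, conjMap_apply, Matrix.mul_apply, Fintype.sum_prod_type,
    Matrix.one_apply, Finset.sum_mul, apply_ite]

theorem isCPTP_conjMap [DecidableEq n] {V : Matrix m n ℂ} (hV : Vᴴ * V = 1) :
    IsCPTP (conjMap V) :=
  ⟨isCompletelyPositive_conjMap V, fun X => by
    rw [conjMap_apply, Matrix.trace_mul_comm, ← Matrix.mul_assoc, hV, Matrix.one_mul]⟩

/-- The map `X ↦ X ⊗ ω`. -/
def kronMap (n : Type*) (ω : Matrix r r ℂ) : Matrix n n ℂ →ₗ[ℂ] Matrix (n × r) (n × r) ℂ where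
  toFun X := X ⊗ₖ ω
  map_add' X Y := Matrix.add_kronecker X Y ω
  map_smul' c X := Matrix.smul_kronecker c X ω

theorem kronMap_apply (ω : Matrix r r ℂ) (X : Matrix n n ℂ) : kronMap n ω X = X ⊗ₖ ω := rfl

theorem isCPTP_kronMap {ω : Matrix r r ℂ} (hω : IsDensity ω) : IsCPTP (kronMap n ω) :=
  ⟨fun k _ hX => (hX.kronecker hω.1).submatrix
      fun x : Fin k × (n × r) => ((x.1, x.2.1), x.2.2), fun X => by
    rw [kronMap_apply, trace_kronecker, hω.2, mul_one]⟩

/-- The partial trace as a linear map. -/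
def partialTraceMap (n r : Type*) [Fintype r] : Matrix (n × r) (n × r) ℂ →ₗ[ℂ] Matrix n n ℂ where
  toFun := partialTrace
  map_add' X Y := by ext; simp [partialTrace, Finset.sum_add_distrib]
  map_smul' c X := by ext; simp [partialTrace, Finset.mul_sum]

theorem partialTraceMap_apply (X : Matrix (n × r) (n × r) ℂ) :
    partialTraceMap n r X = partialTrace X := rfl

theorem isCPTP_partialTraceMap : IsCPTP (partialTraceMap n r) := by
  refine ⟨fun k X hX => ?_, fun X => ?_⟩
  · convert posSemidef_sum Finset.univ fun (a : r) _ =>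
      hX.submatrix fun x : Fin k × n => (x.1, (x.2, a)) using 1
    ext i j
    simp [Matrix.comp_apply, partialTraceMap_apply, partialTrace, Matrix.sum_apply]
  · simp [partialTraceMap_apply, partialTrace, Matrix.trace, Fintype.sum_prod_type]

theorem partialTrace_kronecker (X : Matrix n n ℂ) (ω : Matrix r r ℂ) :
    partialTrace (X ⊗ₖ ω) = ω.trace • X := by
  ext i j
  simp [partialTrace, Matrix.trace, ← Finset.mul_sum, mul_comm]

theorem trace_partialTrace (X : Matrix (n × r) (n × r) ℂ) : (partialTrace X).trace = X.trace :=
  isCPTP_partialTraceMap.tracePreserving X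

theorem partialTrace_mul_kronecker_one [DecidableEq r] (X : Matrix (n × r) (n × r) ℂ)
    (A : Matrix n n ℂ) : partialTrace (X * (A ⊗ₖ 1)) = partialTrace X * A := by
  ext i j
  simp only [partialTrace, Matrix.of_apply, Matrix.mul_apply, Fintype.sum_prod_type,
    kroneckerMap_apply, Matrix.one_apply, mul_ite, mul_one, mul_zero, Finset.sum_ite_eq',
    Finset.mem_univ, if_true, Finset.sum_mul]
  exact Finset.sum_comm

/-! ### Pure states, isometric embeddings and purifications -/

theorem IsPure.isDensity {ρ : Matrix n n ℂ} (h : IsPure ρ) : IsDensity ρ := by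
  obtain ⟨φ, hφ, rfl⟩ := h
  exact ⟨posSemidef_vecMulVec_self_star φ, by rw [trace_vecMulVec, dotProduct_comm, hφ]⟩

theorem IsPure.conjMap [DecidableEq n] {ρ : Matrix n n ℂ} (h : IsPure ρ) {V : Matrix m n ℂ}
    (hV : Vᴴ * V = 1) : IsPure (conjMap V ρ) := by
  obtain ⟨φ, hφ, rfl⟩ := h
  refine ⟨V *ᵥ φ, ?_, ?_⟩
  · rw [star_mulVec, ← dotProduct_mulVec, mulVec_mulVec, hV, one_mulVec, hφ]
  · rw [conjMap_apply, mul_vecMulVec, vecMulVec_mul, star_mulVec]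

theorem IsPure.kronecker {ρ : Matrix n n ℂ} (h : IsPure ρ) {τ : Matrix r r ℂ} (h' : IsPure τ) :
    IsPure (ρ ⊗ₖ τ) := by
  obtain ⟨φ, hφ, rfl⟩ := h
  obtain ⟨ψ, hψ, rfl⟩ := h'
  refine ⟨fun x => φ x.1 * ψ x.2, ?_, ?_⟩
  · calc _ = (star φ ⬝ᵥ φ) * (star ψ ⬝ᵥ ψ) := by
          simp only [dotProduct, Fintype.sum_prod_type, Pi.star_apply, star_mul',
            Finset.sum_mul_sum]
          exact Finset.sum_congr rfl fun i _ => Finset.sum_congr rfl fun j _ => by ring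
      _ = 1 := by rw [hφ, hψ, one_mul]
  · ext i j
    simp only [kroneckerMap_apply, vecMulVec_apply, Pi.star_apply, star_mul']
    ring

/-- A channel with a left inverse channel on `M` preserves trace distances on `M`. -/
theorem IsCPTP.traceDist_eq_of_leftInverse [DecidableEq n] [DecidableEq m]
    {Λ : Matrix n n ℂ →ₗ[ℂ] Matrix m m ℂ} {Γ : Matrix m m ℂ →ₗ[ℂ] Matrix n n ℂ}
    (hΛ : IsCPTP Λ) (hΓ : IsCPTP Γ) {ρ σ : Matrix n n ℂ} (hρ : IsDensity ρ) (hσ : IsDensity σ)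
    (hρ' : Γ (Λ ρ) = ρ) (hσ' : Γ (Λ σ) = σ) : traceDist (Λ ρ) (Λ σ) = traceDist ρ σ := by
  have hX := hρ.1.isHermitian.sub hσ.1.isHermitian
  have hY := (hΛ.isDensity hρ).1.isHermitian.sub (hΛ.isDensity hσ).1.isHermitian
  have h1 := hΛ.traceNorm_le hX
  have h2 := hΓ.traceNorm_le hY
  rw [map_sub, hρ', hσ'] at h2
  rw [map_sub] at h1
  rw [traceDist_eq, traceDist_eq, le_antisymm h1 h2]

/-- The isometry of `ℂ^r` into `ℂ^m` that embeds one standard basis into the other. -/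
def embedMatrix [DecidableEq m] (f : r → m) : Matrix m r ℂ := of fun i j => if i = f j then 1 else 0

theorem embedMatrix_isometry [DecidableEq m] [DecidableEq r] {f : r → m}
    (hf : Function.Injective f) : (embedMatrix f)ᴴ * embedMatrix f = 1 := by
  ext i j
  simp [embedMatrix, Matrix.mul_apply, Matrix.one_apply, hf.eq_iff, eq_comm]

/-- An isometry acting only on the discarded factor is invisible after discarding; this allows the
auxiliary space to be enlarged. -/
theorem partialTrace_conjMap_one_kronecker [DecidableEq n] [DecidableEq r] {J : Matrix m r ℂ}
    (hJ : Jᴴ * J = 1) (X : Matrix (n × r) (n × r) ℂ) :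
    partialTrace (conjMap ((1 : Matrix n n ℂ) ⊗ₖ J) X) = partialTrace X := by
  ext i j
  have hJ' : ∀ a b, ∑ c, star (J c a) * J c b = if a = b then 1 else 0 := fun a b => by
    simpa [Matrix.mul_apply, Matrix.one_apply] using congrFun (congrFun hJ a) b
  calc _ = ∑ c, ∑ b, ∑ a, J c a * X (i, a) (j, b) * star (J c b) := by
        simp [partialTrace, conjMap_apply, Matrix.mul_apply, Fintype.sum_prod_type,
          Matrix.one_apply, Finset.sum_mul, apply_ite]
    _ = ∑ b, ∑ a, X (i, a) (j, b) * ∑ c, star (J c b) * J c a := by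
        rw [Finset.sum_comm]
        refine Finset.sum_congr rfl fun b _ => ?_
        rw [Finset.sum_comm]
        refine Finset.sum_congr rfl fun a _ => ?_
        rw [Finset.mul_sum]
        exact Finset.sum_congr rfl fun c _ => by ring
    _ = _ := by simp_rw [hJ']; simp [partialTrace]

theorem conjTranspose_one_kronecker_mul_self [DecidableEq n] [DecidableEq r] {J : Matrix m r ℂ}
    (hJ : Jᴴ * J = 1) :
    ((1 : Matrix n n ℂ) ⊗ₖ J)ᴴ * ((1 : Matrix n n ℂ) ⊗ₖ J) = 1 := by
  rw [conjTranspose_kronecker, ← mul_kronecker_mul, hJ, conjTranspose_one, Matrix.one_mul,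
    one_kronecker_one]

/-- Enlarging the auxiliary space of a perfect purifier. -/
theorem IsPerfectPurifier.embed [DecidableEq n] [DecidableEq r] [DecidableEq m]
    {M : Set (Matrix n n ℂ)} {Λ : Matrix n n ℂ →ₗ[ℂ] Matrix (n × r) (n × r) ℂ}
    (h : IsPerfectPurifier M Λ) {f : r → m} (hf : Function.Injective f) :
    IsPerfectPurifier M (Purification.conjMap ((1 : Matrix n n ℂ) ⊗ₖ embedMatrix f) ∘ₗ Λ) := by
  have hJ := embedMatrix_isometry hf
  have hV := conjTranspose_one_kronecker_mul_self (n := n) hJ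
  refine ⟨(isCPTP_conjMap hV).comp h.cptp, fun ρ hρ => (h.pure ρ hρ).conjMap hV, fun ρ hρ => ?_⟩
  rw [LinearMap.comp_apply, partialTrace_conjMap_one_kronecker hJ, h.faithful ρ hρ]

theorem partialTrace_kronecker_one_mul_mul [DecidableEq r] (U : Matrix m n ℂ)
    (Y : Matrix (n × r) (n × r) ℂ) :
    partialTrace ((U ⊗ₖ (1 : Matrix r r ℂ)) * Y * (U ⊗ₖ (1 : Matrix r r ℂ))ᴴ) =
      U * partialTrace Y * Uᴴ := by
  ext i j
  simp only [partialTrace, Matrix.of_apply, Matrix.mul_apply, Fintype.sum_prod_type,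
    kroneckerMap_apply, Matrix.one_apply, mul_ite, mul_one, mul_zero, ite_mul, zero_mul,
    conjTranspose_apply, apply_ite star, star_zero, Finset.sum_ite_eq, Finset.mem_univ,
    if_true, Finset.mul_sum, Finset.sum_mul]
  rw [Finset.sum_comm]
  refine Finset.sum_congr rfl fun x _ => ?_
  rw [Finset.sum_comm]

theorem partialTrace_prodAssoc (X : Matrix (n × (r × l)) (n × (r × l)) ℂ) :
    partialTrace X =
      partialTrace (partialTrace (X.submatrix (Equiv.prodAssoc n r l) (Equiv.prodAssoc n r l))) := by
  ext i j
  simp [partialTrace, Fintype.sum_prod_type]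

/-- Every density matrix has a purification. -/
theorem IsDensity.exists_purification {σ : Matrix n n ℂ} (hσ : IsDensity σ) :
    ∃ τ : Matrix (n × n) (n × n) ℂ, IsPure τ ∧ partialTrace τ = σ := by
  obtain ⟨B, hB⟩ := exists_eq_conjTranspose_mul_self hσ.1
  -- The purifying vector is `Bᴴ` read as a vector in the tensor square.
  refine ⟨_, ⟨fun x => Bᴴ x.1 x.2, ?_, rfl⟩, ?_⟩
  · rw [← hσ.2, hB]
    simp only [dotProduct, Fintype.sum_prod_type, Matrix.trace, Matrix.diag_apply,
      Matrix.mul_apply, Pi.star_apply, conjTranspose_apply, star_star]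
    exact Finset.sum_congr rfl fun i _ => Finset.sum_congr rfl fun j _ => mul_comm _ _
  · rw [hB]
    ext i j
    simp [partialTrace, vecMulVec_apply, Matrix.mul_apply]

/-! ### Purifiers of orthogonal unions: (iii) → (i) -/

/-- Existence of a perfect purifier with some finite auxiliary space. -/
def HasPurifier (M : Set (Matrix n n ℂ)) : Prop :=
  ∃ (r : ℕ) (Λ : Matrix n n ℂ →ₗ[ℂ] Matrix (n × Fin r) (n × Fin r) ℂ), IsPerfectPurifier M Λ

theorem IsPerfectPurifier.hasPurifier [DecidableEq n] [DecidableEq r] {M : Set (Matrix n n ℂ)}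
    {Λ : Matrix n n ℂ →ₗ[ℂ] Matrix (n × r) (n × r) ℂ} (h : IsPerfectPurifier M Λ) :
    HasPurifier M :=
  ⟨Fintype.card r, _, h.embed (Fintype.equivFin r).injective⟩

theorem hasPurifier_empty : HasPurifier (∅ : Set (Matrix n n ℂ)) := by
  have h1 : IsDensity (1 : Matrix (Fin 1) (Fin 1) ℂ) := ⟨PosSemidef.one, by simp⟩
  exact ⟨1, kronMap n 1, isCPTP_kronMap h1, by simp, by simp⟩

theorem IsEssentiallyPure.hasPurifier [DecidableEq n] {S : Set (Matrix n n ℂ)}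
    (hS : IsEssentiallyPure S) : HasPurifier S := by
  obtain ⟨r, a, b, ω, σ, U, hω, hσ, hU, hU', h⟩ := hS
  obtain ⟨τ, hτ, hτσ⟩ := hσ.exists_purification
  -- `V` is `U ⊗ 1` rebracketed, so that everything except the original system counts as auxiliary.
  let V : Matrix (n × (Fin r × Fin b)) (Fin a × (Fin b × Fin b)) ℂ :=
    (U ⊗ₖ (1 : Matrix (Fin b) (Fin b) ℂ)).submatrix (Equiv.prodAssoc n (Fin r) (Fin b)).symm
      (Equiv.prodAssoc (Fin a) (Fin b) (Fin b)).symm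
  have hV : Vᴴ * V = 1 := by
    rw [conjTranspose_submatrix, submatrix_mul_equiv, conjTranspose_kronecker,
      ← mul_kronecker_mul, hU', conjTranspose_one, Matrix.one_mul, one_kronecker_one,
      submatrix_one_equiv]
  have hUU : (Uᴴ)ᴴ * Uᴴ = 1 := by rwa [conjTranspose_conjTranspose]
  -- `Γ` extracts the pure state `Φ` from `ρ`.
  let Γ := partialTraceMap (Fin a) (Fin b) ∘ₗ conjMap Uᴴ ∘ₗ kronMap n ω
  have hΓ : IsCPTP Γ := isCPTP_partialTraceMap.comp ((isCPTP_conjMap hUU).comp (isCPTP_kronMap hω))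
  have hΓΦ : ∀ ρ (Φ : Matrix (Fin a) (Fin a) ℂ), ρ ⊗ₖ ω = U * (Φ ⊗ₖ σ) * Uᴴ → Γ ρ = Φ := by
    intro ρ Φ hρ
    simp only [Γ, LinearMap.comp_apply, kronMap_apply, conjMap_apply, hρ, partialTraceMap_apply,
      conjTranspose_conjTranspose]
    have : Uᴴ * (U * (Φ ⊗ₖ σ) * Uᴴ) * U = (Uᴴ * U) * (Φ ⊗ₖ σ) * (Uᴴ * U) := by
      simp only [Matrix.mul_assoc]
    rw [this, hU', Matrix.one_mul, Matrix.mul_one, partialTrace_kronecker, hσ.2, one_smul]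
  refine IsPerfectPurifier.hasPurifier (r := Fin r × Fin b)
    (Λ := conjMap V ∘ₗ kronMap (Fin a) τ ∘ₗ Γ)
    ⟨(isCPTP_conjMap hV).comp ((isCPTP_kronMap hτ.isDensity).comp hΓ), ?_, ?_⟩
  · intro ρ hρ
    obtain ⟨Φ, hΦ, hρΦ⟩ := h ρ hρ
    rw [LinearMap.comp_apply, LinearMap.comp_apply, hΓΦ ρ Φ hρΦ, kronMap_apply]
    exact (hΦ.kronecker hτ).conjMap hV
  · intro ρ hρ
    obtain ⟨Φ, hΦ, hρΦ⟩ := h ρ hρ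
    rw [LinearMap.comp_apply, LinearMap.comp_apply, hΓΦ ρ Φ hρΦ, kronMap_apply, conjMap_apply,
      partialTrace_prodAssoc]
    have e1 : (V * (Φ ⊗ₖ τ) * Vᴴ).submatrix (Equiv.prodAssoc n (Fin r) (Fin b))
        (Equiv.prodAssoc n (Fin r) (Fin b)) = (U ⊗ₖ (1 : Matrix (Fin b) (Fin b) ℂ)) *
          (Φ ⊗ₖ τ).submatrix (Equiv.prodAssoc (Fin a) (Fin b) (Fin b))
            (Equiv.prodAssoc (Fin a) (Fin b) (Fin b)) *
          (U ⊗ₖ (1 : Matrix (Fin b) (Fin b) ℂ))ᴴ := by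
      simp only [V, conjTranspose_submatrix]
      rw [← submatrix_mul_equiv _ _ _ (Equiv.prodAssoc (Fin a) (Fin b) (Fin b)),
        ← submatrix_mul_equiv _ _ _ (Equiv.prodAssoc (Fin a) (Fin b) (Fin b))]
      simp [submatrix_submatrix]
    have e2 : partialTrace ((Φ ⊗ₖ τ).submatrix (Equiv.prodAssoc (Fin a) (Fin b) (Fin b))
        (Equiv.prodAssoc (Fin a) (Fin b) (Fin b))) = Φ ⊗ₖ σ := by
      rw [← hτσ]
      ext i j
      simp [partialTrace, Finset.mul_sum]
    rw [e1, partialTrace_kronecker_one_mul_mul, e2, ← hρΦ, partialTrace_kronecker, hω.2, one_smul]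

/-- Orthogonal sets of states are separated by an orthogonal projection. -/
theorem exists_projection [DecidableEq n] {M N : Set (Matrix n n ℂ)}
    (hN : ∀ τ ∈ N, IsDensity τ) (h : ∀ τ ∈ N, ∀ ρ ∈ M, τ * ρ = 0) :
    ∃ P : Matrix n n ℂ, Pᴴ = P ∧ P * P = P ∧ (∀ ρ ∈ M, P * ρ = ρ) ∧ ∀ τ ∈ N, P * τ = 0 := by
  let T := toEuclideanCLM (n := n) (𝕜 := ℂ)
  -- `K` is the common kernel of all states in `N`; it contains the range of every `ρ ∈ M`.
  let K : Submodule ℂ (EuclideanSpace ℂ n) := ⨅ τ : N, (T τ.1).ker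
  have hK : ∀ v, v ∈ K ↔ ∀ τ ∈ N, T τ v = 0 := fun v => by simp [K, Submodule.mem_iInf]
  have hTP : T (T.symm K.starProjection) = K.starProjection := T.apply_symm_apply _
  have hPH : (T.symm K.starProjection)ᴴ = T.symm K.starProjection := by
    apply EquivLike.injective T
    rw [← star_eq_conjTranspose, map_star T, hTP]
    exact isSelfAdjoint_starProjection K
  refine ⟨T.symm K.starProjection, hPH, ?_, ?_, ?_⟩
  · rw [← map_mul]
    exact congrArg _ K.isIdempotentElem_starProjection
  · intro ρ hρ
    apply EquivLike.injective T
    ext1 v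
    rw [map_mul, hTP]
    refine Submodule.starProjection_eq_self_iff.mpr ((hK _).mpr fun τ hτ => ?_)
    have h0 : T τ * T ρ = 0 := by rw [← map_mul, h τ hτ ρ hρ, map_zero]
    exact DFunLike.congr_fun h0 v
  · intro τ hτ
    have h0 : τ * T.symm K.starProjection = 0 := by
      apply EquivLike.injective T
      ext1 v
      rw [map_mul, hTP, map_zero]
      exact (hK _).mp (K.starProjection_apply_mem v) τ hτ
    simpa [conjTranspose_mul, hPH, (hN τ hτ).1.isHermitian.eq] using congrArg conjTranspose h0

/-- Measure which of the two orthogonal supports holds the state, then apply the matching purifier;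
the measurement leaves each state of `M ∪ N` undisturbed. -/
theorem HasPurifier.union [DecidableEq n] {M N : Set (Matrix n n ℂ)}
    (hM : HasPurifier M) (hN : HasPurifier N) (hMd : ∀ ρ ∈ M, IsDensity ρ)
    (hNd : ∀ τ ∈ N, IsDensity τ) (h : ∀ τ ∈ N, ∀ ρ ∈ M, τ * ρ = 0) : HasPurifier (M ∪ N) := by
  obtain ⟨r₁, Λ₁, h₁⟩ := hM
  obtain ⟨r₂, Λ₂, h₂⟩ := hN
  -- Both purifiers need the same output space before they can be added, hence the auxiliary
  -- dimension `max r₁ r₂`.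
  replace h₁ := h₁.embed (Fin.castLE_injective (le_max_left r₁ r₂))
  replace h₂ := h₂.embed (Fin.castLE_injective (le_max_right r₁ r₂))
  generalize conjMap _ ∘ₗ Λ₁ = Γ₁ at h₁
  generalize conjMap _ ∘ₗ Λ₂ = Γ₂ at h₂
  obtain ⟨P, hPH, hPP, hPM, hPN⟩ := exists_projection hNd h
  have hQH : (1 - P)ᴴ = 1 - P := by rw [conjTranspose_sub, conjTranspose_one, hPH]
  have hQQ : (1 - P) * (1 - P) = 1 - P := by
    rw [mul_sub, mul_one, sub_mul, hPP, one_mul, sub_self, sub_zero]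
  have aux : ∀ Q ρ : Matrix n n ℂ, Qᴴ = Q → ρ.IsHermitian → Q * ρ = ρ →
      conjMap Q ρ = ρ ∧ conjMap (1 - Q) ρ = 0 := by
    intro Q ρ hQ hρ hQρ
    have : ρ * Q = ρ := by
      simpa [conjTranspose_mul, hQ, hρ.eq] using congrArg conjTranspose hQρ
    constructor
    · rw [conjMap_apply, hQ, hQρ, this]
    · rw [conjMap_apply, sub_mul, one_mul, hQρ, sub_self, Matrix.zero_mul]
  let Λ := Γ₁ ∘ₗ conjMap P + Γ₂ ∘ₗ conjMap (1 - P)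
  have hΛM : ∀ ρ ∈ M, Λ ρ = Γ₁ ρ := fun ρ hρ => by
    obtain ⟨e1, e2⟩ := aux P ρ hPH (hMd ρ hρ).1.isHermitian (hPM ρ hρ)
    simp [Λ, e1, e2]
  have hΛN : ∀ τ ∈ N, Λ τ = Γ₂ τ := fun τ hτ => by
    obtain ⟨e1, e2⟩ := aux (1 - P) τ hQH (hNd τ hτ).1.isHermitian
      (by rw [sub_mul, hPN τ hτ, one_mul, sub_zero])
    rw [sub_sub_cancel] at e2
    simp [Λ, e1, e2]
  refine ⟨max r₁ r₂, Λ, ⟨?_, fun X => ?_⟩, ?_, ?_⟩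
  · exact (h₁.cptp.completelyPositive.comp (isCompletelyPositive_conjMap P)).add
      (h₂.cptp.completelyPositive.comp (isCompletelyPositive_conjMap (1 - P)))
  · simp only [Λ, LinearMap.add_apply, LinearMap.comp_apply, trace_add,
      h₁.cptp.tracePreserving, h₂.cptp.tracePreserving, conjMap_apply]
    rw [Matrix.trace_mul_comm, ← Matrix.mul_assoc, hPH, hPP,
      Matrix.trace_mul_comm ((1 - P) * X), ← Matrix.mul_assoc, hQH, hQQ, ← trace_add, ← add_mul,
      add_sub_cancel, Matrix.one_mul]
  · rintro ρ (hρ | hρ)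
    · rw [hΛM ρ hρ]; exact h₁.pure ρ hρ
    · rw [hΛN ρ hρ]; exact h₂.pure ρ hρ
  · rintro ρ (hρ | hρ)
    · rw [hΛM ρ hρ]; exact h₁.faithful ρ hρ
    · rw [hΛN ρ hρ]; exact h₂.faithful ρ hρ

theorem IsDensity.mul_self_ne_zero {ρ : Matrix n n ℂ} (hρ : IsDensity ρ) : ρ * ρ ≠ 0 := by
  intro h
  have h1 : ρᴴ * ρ = 0 := by rwa [hρ.1.isHermitian.eq]
  have h0 : ρ = 0 := conjTranspose_mul_self_eq_zero.mp h1
  simpa [h0] using hρ.2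

/-- A family of mutually orthogonal states is finite. -/
theorem finite_of_orthogonal [DecidableEq n] {ι : Type*} (f : ι → Matrix n n ℂ)
    (hf : ∀ i, IsDensity (f i)) (h : ∀ i j, i ≠ j → f i * f j = 0) : Finite ι := by
  have : LinearIndependent ℂ f := by
    rw [linearIndependent_iff']
    intro s g hg i hi
    -- Right multiplication by `f i` kills every other term of a linear relation.
    have h1 : (∑ j ∈ s, g j • f j) * f i = g i • (f i * f i) := by
      rw [Finset.sum_mul, Finset.sum_eq_single_of_mem i hi, smul_mul_assoc]
      intro j _ hj
      rw [smul_mul_assoc, h j i hj, smul_zero]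
    rw [hg, Matrix.zero_mul] at h1
    exact (smul_eq_zero.mp h1.symm).resolve_right (hf i).mul_self_ne_zero
  exact this.finite

theorem HasPurifier.of_orthogonalUnion [DecidableEq n] {M : Set (Matrix n n ℂ)}
    (hM : ∀ ρ ∈ M, IsDensity ρ) (h : IsOrthogonalUnionOfEssentiallyPure M) : HasPurifier M := by
  obtain ⟨C, rfl, hC, horth⟩ := h
  -- One representative per nonempty member gives mutually orthogonal states. Empty members have no
  -- representative and are dropped.
  have hfin : {S ∈ C | S.Nonempty}.Finite := by
    have := finite_of_orthogonal
      (fun S : {S ∈ C | S.Nonempty} => S.2.2.some) (fun S => hM _ ⟨S, S.2.1, S.2.2.some_mem⟩)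
      fun S T hST => horth S S.2.1 T T.2.1 (fun e => hST (Subtype.ext e)) _ S.2.2.some_mem _
        T.2.2.some_mem
    exact Set.toFinite _
  have hU : ⋃₀ C = ⋃₀ {S ∈ C | S.Nonempty} := by
    ext ρ
    exact ⟨fun ⟨S, hS, hρ⟩ => ⟨S, ⟨hS, ρ, hρ⟩, hρ⟩, fun ⟨S, hS, hρ⟩ => ⟨S, hS.1, hρ⟩⟩
  rw [hU]
  suffices ∀ D : Set (Set (Matrix n n ℂ)), D.Finite → D ⊆ C → HasPurifier (⋃₀ D) from
    this _ hfin fun S hS => hS.1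
  intro D hD
  induction D, hD using Set.Finite.induction_on with
  | empty => intro _; rw [Set.sUnion_empty]; exact hasPurifier_empty
  | @insert S D hSD _ ih =>
    intro hDC
    have hS : S ∈ C := hDC (Set.mem_insert S D)
    have hD' : D ⊆ C := fun T hT => hDC (Set.mem_insert_of_mem S hT)
    rw [Set.sUnion_insert]
    refine (hC S hS).hasPurifier.union (ih hD') (fun ρ hρ => hM ρ ⟨S, hS, hρ⟩)
      (fun τ ⟨T, hT, hτ⟩ => hM τ ⟨T, hD' hT, hτ⟩) ?_
    rintro τ ⟨T, hT, hτ⟩ ρ hρ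
    exact horth T (hD' hT) S hS (fun e => hSD (e ▸ hT)) τ hτ ρ hρ

/-! ### Purifiers preserve distances: (i) → (ii) -/

/-- A perfect purifier preserves trace distances. -/
theorem HasPurifier.exists_traceDist_eq [DecidableEq n] {M : Set (Matrix n n ℂ)}
    (hM : ∀ ρ ∈ M, IsDensity ρ) (h : HasPurifier M) :
    ∃ (m : ℕ) (Λ : Matrix n n ℂ →ₗ[ℂ] Matrix (Fin m) (Fin m) ℂ), IsCPTP Λ ∧
      (∀ ρ ∈ M, IsPure (Λ ρ)) ∧
      ∀ ρ ∈ M, ∀ ρ' ∈ M, traceDist (Λ ρ) (Λ ρ') = traceDist ρ ρ' := by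
  obtain ⟨r, Λ, hΛ⟩ := h
  let e := Fintype.equivFin (n × Fin r)
  have he := embedMatrix_isometry e.injective
  have he' : embedMatrix e * (embedMatrix e)ᴴ = 1 := mul_eq_one_comm_of_equiv e |>.mp he
  have hback := isCPTP_conjMap (V := (embedMatrix e)ᴴ) (by rwa [conjTranspose_conjTranspose])
  have hleft : ∀ ρ ∈ M, (partialTraceMap n (Fin r) ∘ₗ conjMap (embedMatrix e)ᴴ)
      ((conjMap (embedMatrix e) ∘ₗ Λ) ρ) = ρ := by
    intro ρ hρ
    have : (embedMatrix e)ᴴ * (embedMatrix e * Λ ρ * (embedMatrix e)ᴴ) * embedMatrix e =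
        ((embedMatrix e)ᴴ * embedMatrix e) * Λ ρ * ((embedMatrix e)ᴴ * embedMatrix e) := by
      simp only [Matrix.mul_assoc]
    simp only [LinearMap.comp_apply, conjMap_apply, conjTranspose_conjTranspose, this, he,
      Matrix.one_mul, Matrix.mul_one, partialTraceMap_apply, hΛ.faithful ρ hρ]
  refine ⟨_, conjMap (embedMatrix e) ∘ₗ Λ, (isCPTP_conjMap he).comp hΛ.cptp,
    fun ρ hρ => (hΛ.pure ρ hρ).conjMap he, fun ρ hρ ρ' hρ' => ?_⟩
  exact ((isCPTP_conjMap he).comp hΛ.cptp).traceDist_eq_of_leftInverse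
    (isCPTP_partialTraceMap.comp hback) (hM ρ hρ) (hM ρ' hρ') (hleft ρ hρ) (hleft ρ' hρ')

/-! ### Choi matrix and Stinespring dilation -/

/-- The Choi matrix of a completely positive map is positive semidefinite. -/
theorem IsCompletelyPositive.posSemidef_choi [DecidableEq n]
    {Λ : Matrix n n ℂ →ₗ[ℂ] Matrix m m ℂ} (h : IsCompletelyPositive Λ) :
    (of fun x y : n × m => Λ (single x.1 y.1 1) x.2 y.2 : Matrix (n × m) (n × m) ℂ).PosSemidef := by
  let e := Fintype.equivFin n
  let X : Matrix (Fin (Fintype.card n)) (Fin (Fintype.card n)) (Matrix n n ℂ) :=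
    of fun a b => single (e.symm a) (e.symm b) 1
  have hX : (Matrix.comp _ _ n n ℂ X).PosSemidef := by
    -- The block matrix of matrix units is the unnormalised maximally entangled projector.
    convert posSemidef_vecMulVec_self_star
      (fun x : Fin (Fintype.card n) × n => if e.symm x.1 = x.2 then (1 : ℂ) else 0) using 1
    ext x y
    by_cases h1 : e.symm x.1 = x.2 <;> by_cases h2 : e.symm y.1 = y.2 <;>
      simp [X, Matrix.comp_apply, vecMulVec_apply, h1, h2]
  convert (h _ X hX).submatrix fun x : n × m => (e x.1, x.2) using 1
  ext x y
  simp [X, Matrix.comp_apply]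

/-- Stinespring dilation of a channel. -/
theorem IsCPTP.exists_isometry [DecidableEq n] {Λ : Matrix n n ℂ →ₗ[ℂ] Matrix m m ℂ}
    (h : IsCPTP Λ) (e : l ≃ n × m) :
    ∃ V : Matrix (m × l) n ℂ, Vᴴ * V = 1 ∧ ∀ X, Λ X = partialTrace (V * X * Vᴴ) := by
  obtain ⟨B, hB⟩ := exists_eq_conjTranspose_mul_self h.completelyPositive.posSemidef_choi
  have hC : ∀ i j p q, Λ (single i j 1) p q = ∑ t, star (B (e t) (i, p)) * B (e t) (j, q) := by
    intro i j p q
    have := congrFun (congrFun hB (i, p)) (j, q)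
    rw [Matrix.mul_apply, ← e.sum_comp] at this
    exact this
  -- Each row of the Choi factor `B` encodes a Kraus operator; `V` stacks them along the environment
  -- index.
  let V : Matrix (m × l) n ℂ := of fun x i => star (B (e x.2) (i, x.1))
  have hV : ∀ X, Λ X = partialTrace (V * X * Vᴴ) := by
    intro X
    ext p q
    have hX : Λ X = ∑ i, ∑ j, X i j • Λ (single i j 1) := by
      conv_lhs => rw [matrix_eq_sum_single X]
      simp only [map_sum]
      refine Finset.sum_congr rfl fun i _ => Finset.sum_congr rfl fun j _ => ?_
      rw [← map_smul, smul_single, smul_eq_mul, mul_one]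
    rw [hX]
    simp only [Matrix.sum_apply, Matrix.smul_apply, smul_eq_mul, hC, partialTrace, Matrix.of_apply,
      Matrix.mul_apply, conjTranspose_apply, V, star_star, Finset.mul_sum, Finset.sum_mul]
    calc _ = ∑ i, ∑ t, ∑ j, X i j * (star (B (e t) (i, p)) * B (e t) (j, q)) :=
          Finset.sum_congr rfl fun i _ => Finset.sum_comm
      _ = ∑ t, ∑ i, ∑ j, X i j * (star (B (e t) (i, p)) * B (e t) (j, q)) := Finset.sum_comm
      _ = _ := by
          refine Finset.sum_congr rfl fun t _ => ?_
          rw [Finset.sum_comm]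
          exact Finset.sum_congr rfl fun j _ => Finset.sum_congr rfl fun i _ => by ring
  refine ⟨V, ?_, hV⟩
  -- Trace preservation is `Vᴴ * V = 1` paired with every `X`.
  rw [ext_iff_trace_mul_right]
  intro X
  rw [Matrix.one_mul, ← h.tracePreserving X, hV X, trace_partialTrace,
    Matrix.trace_mul_comm (V * X), Matrix.mul_assoc]

/-! ### Rigidity of distance-preserving purification: (ii) → (iii) -/

theorem vecMulVec_mul_self {φ : n → ℂ} (hφ : star φ ⬝ᵥ φ = 1) :
    vecMulVec φ (star φ) * vecMulVec φ (star φ) = vecMulVec φ (star φ) := by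
  rw [vecMulVec_mul_vecMulVec, hφ, one_smul]

/-- A state whose first marginal is pure is a product state. -/
theorem exists_eq_kronecker_of_partialTrace {Y : Matrix (m × l) (m × l) ℂ} (hY : Y.PosSemidef)
    {φ : m → ℂ} (hφ : star φ ⬝ᵥ φ = 1) (h : partialTrace Y = vecMulVec φ (star φ)) :
    ∃ σ : Matrix l l ℂ, IsDensity σ ∧ Y = vecMulVec φ (star φ) ⊗ₖ σ := by
  classical
  have hF := vecMulVec_mul_self hφ
  have hFd : IsDensity (vecMulVec φ (star φ)) := IsPure.isDensity ⟨φ, hφ, rfl⟩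
  -- `W` is the map `ψ ↦ φ ⊗ ψ`; compressing `Y` by it gives the second factor.
  let W : Matrix (m × l) l ℂ := of fun x b => if x.2 = b then φ x.1 else 0
  have hWW : W * Wᴴ = vecMulVec φ (star φ) ⊗ₖ 1 := by
    ext ⟨p, b⟩ ⟨q, c⟩
    by_cases hbc : b = c <;>
      simp [W, Matrix.mul_apply, vecMulVec_apply, apply_ite, hbc, eq_comm (a := c)]
  have hWσ : ∀ σ : Matrix l l ℂ, W * σ * Wᴴ = vecMulVec φ (star φ) ⊗ₖ σ := by
    intro σ
    ext ⟨p, b⟩ ⟨q, c⟩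
    simp [W, Matrix.mul_apply, vecMulVec_apply, apply_ite]
    ring
  generalize vecMulVec φ (star φ) = F at *
  have hQ : (1 - F).PosSemidef := by
    have h1 : (1 - F)ᴴ * (1 - F) = 1 - F := by
      rw [conjTranspose_sub, conjTranspose_one, hFd.1.isHermitian.eq, mul_sub, mul_one, sub_mul,
        hF, one_mul, sub_self, sub_zero]
    exact h1 ▸ posSemidef_conjTranspose_mul_self (1 - F)
  -- The marginal `F` gives `Y` zero weight on `(1 - F) ⊗ 1`, so `Y` is supported on `F ⊗ 1`.
  have h0 : Y * ((1 - F) ⊗ₖ (1 : Matrix l l ℂ)) = 0 := by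
    refine mul_eq_zero_of_trace_mul_eq_zero hY (hQ.kronecker PosSemidef.one) ?_
    rw [← trace_partialTrace, partialTrace_mul_kronecker_one, h, mul_sub, hF, mul_one, sub_self,
      trace_zero]
  have h1 : Y * (F ⊗ₖ (1 : Matrix l l ℂ)) = Y := by
    have e : (1 - F) ⊗ₖ (1 : Matrix l l ℂ) = 1 - F ⊗ₖ 1 := by
      rw [eq_sub_iff_add_eq, ← add_kronecker, sub_add_cancel, one_kronecker_one]
    rw [e, mul_sub, mul_one, sub_eq_zero] at h0
    exact h0.symm
  have h2 : (F ⊗ₖ (1 : Matrix l l ℂ)) * Y = Y := by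
    simpa [conjTranspose_mul, conjTranspose_kronecker, hY.isHermitian.eq,
      hFd.1.isHermitian.eq] using congrArg conjTranspose h1
  have h3 : Y = F ⊗ₖ (Wᴴ * Y * W) := by
    rw [← hWσ]
    calc Y = (W * Wᴴ) * Y * (W * Wᴴ) := by rw [hWW, h2, h1]
      _ = _ := by simp only [Matrix.mul_assoc]
  refine ⟨Wᴴ * Y * W, ⟨hY.conjTranspose_mul_mul_same W, ?_⟩, h3⟩
  have h4 := congrArg trace h3
  rwa [trace_kronecker, hFd.2, one_mul, ← trace_partialTrace, h, hFd.2, eq_comm] at h4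

theorem eigenvector_of_commute {φ : n → ℂ} (hφ : star φ ⬝ᵥ φ = 1) {S : Matrix n n ℂ}
    (h : vecMulVec φ (star φ) * S = S * vecMulVec φ (star φ)) :
    S *ᵥ φ = (star φ ⬝ᵥ S *ᵥ φ) • φ := by
  have h1 := congrArg (· *ᵥ φ) h
  simp only [← mulVec_mulVec, vecMulVec_mulVec, hφ] at h1
  simpa using h1.symm

theorem trace_vecMulVec_star_mul (φ : n → ℂ) (S : Matrix n n ℂ) :
    (vecMulVec φ (star φ) * S).trace = star φ ⬝ᵥ S *ᵥ φ := by
  rw [vecMulVec_mul, trace_vecMulVec, dotProduct_comm, dotProduct_mulVec]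

/-- If discarding the environment does not decrease the trace distance of two product states with
pure first factor and different second factors, then these states are equal or orthogonal. -/
theorem mul_eq_zero_of_traceNorm_eq [DecidableEq n] [DecidableEq m] {V : Matrix (m × l) n ℂ}
    (hV : Vᴴ * V = 1) {ρ ρ' : Matrix n n ℂ} (hρ : IsDensity ρ) (hρ' : IsDensity ρ')
    {φ φ' : m → ℂ} (hφ : star φ ⬝ᵥ φ = 1) (hφ' : star φ' ⬝ᵥ φ' = 1) {σ σ' : Matrix l l ℂ}
    (hσ : IsDensity σ) (hσ' : IsDensity σ') (h : V * ρ * Vᴴ = vecMulVec φ (star φ) ⊗ₖ σ)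
    (h' : V * ρ' * Vᴴ = vecMulVec φ' (star φ') ⊗ₖ σ')
    (hd : traceNorm (vecMulVec φ (star φ) - vecMulVec φ' (star φ')) = traceNorm (ρ - ρ'))
    (hne : σ ≠ σ') (hρne : ρ ≠ ρ') : ρ * ρ' = 0 := by
  classical
  set F := vecMulVec φ (star φ) with hF
  set F' := vecMulVec φ' (star φ') with hF'
  have hFd : IsDensity F := IsPure.isDensity ⟨φ, hφ, rfl⟩
  have hFd' : IsDensity F' := IsPure.isDensity ⟨φ', hφ', rfl⟩
  have hH := hρ.1.isHermitian.sub hρ'.1.isHermitian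
  have hX : conjMap V (ρ - ρ') = F ⊗ₖ σ - F' ⊗ₖ σ' := by
    rw [map_sub, conjMap_apply, conjMap_apply, h, h']
  obtain ⟨-, -, S, -, -, hS, hS1, hS2, -, -, hSt⟩ :=
    exists_jordan_decomposition (hFd.1.isHermitian.sub hFd'.1.isHermitian)
  have hkS : ((1 - S) ⊗ₖ (1 : Matrix l l ℂ)) = 1 - S ⊗ₖ 1 := by
    rw [eq_sub_iff_add_eq, ← add_kronecker, sub_add_cancel, one_kronecker_one]
  have hkS' : ((1 + S) ⊗ₖ (1 : Matrix l l ℂ)) = 1 + S ⊗ₖ 1 := by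
    rw [add_kronecker, one_kronecker_one]
  have hpt : partialTrace (F ⊗ₖ σ - F' ⊗ₖ σ') = F - F' := by
    rw [← partialTraceMap_apply, map_sub, partialTraceMap_apply, partialTraceMap_apply,
      partialTrace_kronecker, partialTrace_kronecker, hσ.2, hσ'.2, one_smul, one_smul]
  -- The expectation of `S ⊗ 1` depends only on the marginal difference `F - F'`, whose norm `hd`
  -- equates with that of `ρ - ρ'`. This is the equality case of `commute_of_traceNorm_le`.
  have hcomm : (F ⊗ₖ σ - F' ⊗ₖ σ') * (S ⊗ₖ 1) = (S ⊗ₖ 1) * (F ⊗ₖ σ - F' ⊗ₖ σ') := by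
    refine commute_of_traceNorm_le ?_ ?_ (hkS ▸ hS1.kronecker PosSemidef.one)
      (hkS' ▸ hS2.kronecker PosSemidef.one) ?_
    · exact (hFd.1.kronecker hσ.1).isHermitian.sub (hFd'.1.kronecker hσ'.1).isHermitian
    · rw [IsHermitian, conjTranspose_kronecker, hS.eq, conjTranspose_one]
    · rw [← trace_partialTrace, partialTrace_mul_kronecker_one, hpt, ← hSt, hd, ← hX]
      exact (isCPTP_conjMap hV).traceNorm_le hH
  have hk : (F * S - S * F) ⊗ₖ σ = (F' * S - S * F') ⊗ₖ σ' := by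
    simp only [sub_mul, mul_sub, ← mul_kronecker_mul, Matrix.one_mul, Matrix.mul_one] at hcomm
    have sk : ∀ (A B : Matrix m m ℂ) (C : Matrix l l ℂ), (A - B) ⊗ₖ C = A ⊗ₖ C - B ⊗ₖ C := by
      intro A B C
      rw [eq_sub_iff_add_eq, ← add_kronecker, sub_add_cancel]
    rw [sk, sk]
    rw [sub_eq_sub_iff_add_eq_add] at hcomm ⊢
    rw [hcomm, add_comm]
  have hC : F * S - S * F = F' * S - S * F' := by
    have := congrArg partialTrace hk
    rwa [partialTrace_kronecker, partialTrace_kronecker, hσ.2, hσ'.2, one_smul, one_smul] at this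
  -- A nonzero entry of the common commutator could be cancelled in `hk`, giving `σ = σ'`.
  have hC0 : F * S - S * F = 0 := by
    by_contra hC0
    refine hne (Matrix.ext fun b c => ?_)
    rw [← hC] at hk
    have : ∃ p q, (F * S - S * F) p q ≠ 0 := by
      by_contra! hall
      exact hC0 (Matrix.ext hall)
    obtain ⟨p, q, hpq⟩ := this
    exact mul_left_cancel₀ hpq (congrFun (congrFun hk (p, b)) (q, c))
  have hS3 := eigenvector_of_commute hφ (sub_eq_zero.mp hC0)
  have hS4 := eigenvector_of_commute hφ' (sub_eq_zero.mp (hC ▸ hC0))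
  have hs1 := trace_vecMulVec_star_mul φ S
  have hs2 := trace_vecMulVec_star_mul φ' S
  generalize star φ ⬝ᵥ S *ᵥ φ = s at hS3 hs1
  generalize star φ' ⬝ᵥ S *ᵥ φ' = s' at hS4 hs2
  -- Move the Hermitian `S` across the inner product of its two eigenvectors.
  have hc : star s * (star φ ⬝ᵥ φ') = s' * (star φ ⬝ᵥ φ') := by
    calc star s * (star φ ⬝ᵥ φ') = star (S *ᵥ φ) ⬝ᵥ φ' := by
          rw [hS3, star_smul, smul_dotProduct, smul_eq_mul]
      _ = star φ ⬝ᵥ (S *ᵥ φ') := by rw [star_mulVec, hS.eq, dotProduct_mulVec]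
      _ = s' * (star φ ⬝ᵥ φ') := by rw [hS4, dotProduct_smul, smul_eq_mul]
  by_cases hφφ : star φ ⬝ᵥ φ' = 0
  · have hFF : F * F' = 0 := by
      rw [hF, hF', vecMulVec_mul_vecMulVec, hφφ, zero_smul, vecMulVec_zero]
    calc ρ * ρ' = (Vᴴ * V) * ρ * (Vᴴ * V) * ρ' * (Vᴴ * V) := by simp [hV]
      _ = Vᴴ * ((V * ρ * Vᴴ) * (V * ρ' * Vᴴ)) * V := by simp only [Matrix.mul_assoc]
      _ = 0 := by
        rw [h, h', ← mul_kronecker_mul, hFF, zero_kronecker, Matrix.mul_zero, Matrix.zero_mul]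
  · have hss := mul_right_cancel₀ hφφ hc
    refine absurd (sub_eq_zero.mp (eq_zero_of_traceNorm_eq_zero hH ?_)) hρne
    -- The norm is the real part of `s - star s`, which is zero.
    rw [← hd, hSt, sub_mul, trace_sub, hs1, hs2, ← hss]
    simp

/-! ### Unitary extension and grouping by environment state -/

/-- An isometry extends to a unitary. -/
theorem exists_unitary_extension [DecidableEq m] [DecidableEq l] [DecidableEq n]
    (hcard : Fintype.card m = Fintype.card l)
    {f : n → l} (hf : Function.Injective f) {V : Matrix m n ℂ} (hV : Vᴴ * V = 1) :
    ∃ G : Matrix m l ℂ, Gᴴ * G = 1 ∧ G * Gᴴ = 1 ∧ ∀ x j, G x (f j) = V x j := by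
  have hV' : ∀ i j, ∑ x, star (V x i) * V x j = if i = j then 1 else 0 := fun i j => by
    simpa [Matrix.mul_apply, Matrix.one_apply] using congrFun (congrFun hV i) j
  let v : l → EuclideanSpace ℂ m := Function.extend f (fun j => WithLp.toLp 2 (V · j)) 0
  have hvf : ∀ j, v (f j) = WithLp.toLp 2 (V · j) := fun j => hf.extend_apply _ _ j
  have hv : Orthonormal ℂ ((Set.range f).domRestrict v) := by
    rw [orthonormal_iff_ite]
    rintro ⟨_, i, rfl⟩ ⟨_, j, rfl⟩
    have hij : ((⟨f i, i, rfl⟩ : Set.range f) = ⟨f j, j, rfl⟩) ↔ i = j :=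
      Subtype.ext_iff.trans hf.eq_iff
    simp only [Set.domRestrict_apply, hvf, hij]
    rw [EuclideanSpace.inner_eq_star_dotProduct]
    refine Eq.trans ?_ (hV' i j)
    simp [dotProduct, mul_comm]
  obtain ⟨b, hb⟩ := hv.exists_orthonormalBasis_extension_of_card_eq
    (by rw [finrank_euclideanSpace, hcard])
  let G : Matrix m l ℂ := of fun x j => b j x
  have hG : Gᴴ * G = 1 := by
    ext i j
    have := orthonormal_iff_ite.mp b.orthonormal i j
    rw [EuclideanSpace.inner_eq_star_dotProduct] at this
    rw [Matrix.one_apply, ← this]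
    simp [G, Matrix.mul_apply, dotProduct, mul_comm]
  refine ⟨G, hG, (mul_eq_one_comm_of_card_eq _ _ _ hcard.symm).mp hG, fun x j => ?_⟩
  simp [G, hb (f j) ⟨j, rfl⟩, hvf]

/-- Appending the basis state `z` is an isometry `J`, and `V = G * J` with `G` unitary. Hence `ρ ⊗
|z⟩⟨z| = J ρ J†` is `V ρ V†` rotated back by `U = Gᴴ`. -/
theorem isEssentiallyPure_of_isometry [DecidableEq n] {S : Set (Matrix n n ℂ)} {a b r : ℕ}
    (hcard : a * b = Fintype.card n * r) (z : Fin r) {V : Matrix (Fin a × Fin b) n ℂ}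
    (hV : Vᴴ * V = 1) {σ : Matrix (Fin b) (Fin b) ℂ} (hσ : IsDensity σ)
    (h : ∀ ρ ∈ S, ∃ Φ : Matrix (Fin a) (Fin a) ℂ, IsPure Φ ∧ V * ρ * Vᴴ = Φ ⊗ₖ σ) :
    IsEssentiallyPure S := by
  obtain ⟨G, hG, hG', hGV⟩ := exists_unitary_extension (l := n × Fin r) (by simpa using hcard)
    (f := fun i => (i, z)) (fun i j hij => congrArg Prod.fst hij) hV
  let J : Matrix (n × Fin r) n ℂ := embedMatrix fun i => (i, z)
  have hGJ : V = G * J := by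
    ext x j
    simp [J, embedMatrix, Matrix.mul_apply, hGV]
  refine ⟨r, a, b, single z z 1, σ, Gᴴ, ⟨?_, by simp⟩, hσ, ?_, ?_, fun ρ hρ => ?_⟩
  · convert posSemidef_vecMulVec_self_star (Pi.single z 1 : Fin r → ℂ) using 1
    ext i j
    by_cases h1 : i = z <;> by_cases h2 : j = z <;>
      simp [vecMulVec_apply, h1, h2, eq_comm (a := z)]
  · rwa [conjTranspose_conjTranspose]
  · rwa [conjTranspose_conjTranspose]
  · obtain ⟨Φ, hΦ, e⟩ := h ρ hρ
    refine ⟨Φ, hΦ, ?_⟩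
    have : Gᴴ * (G * J * ρ * (G * J)ᴴ) * Gᴴᴴ = (Gᴴ * G) * (J * ρ * Jᴴ) * (Gᴴ * G) := by
      simp only [conjTranspose_mul, conjTranspose_conjTranspose, Matrix.mul_assoc]
    rw [← e, hGJ, this, hG, Matrix.one_mul, Matrix.mul_one]
    ext ⟨i, k⟩ ⟨j, c⟩
    by_cases h1 : k = z <;> by_cases h2 : c = z <;>
      simp [J, embedMatrix, Matrix.mul_apply, apply_ite, h1, h2,
        eq_comm (a := z)]

theorem isOrthogonalUnion_of_traceDist_eq [DecidableEq n] {M : Set (Matrix n n ℂ)}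
    (hM : ∀ ρ ∈ M, IsDensity ρ) {m : ℕ} {Λ : Matrix n n ℂ →ₗ[ℂ] Matrix (Fin m) (Fin m) ℂ}
    (hΛ : IsCPTP Λ) (hpure : ∀ ρ ∈ M, IsPure (Λ ρ))
    (hdist : ∀ ρ ∈ M, ∀ ρ' ∈ M, traceDist (Λ ρ) (Λ ρ') = traceDist ρ ρ') :
    IsOrthogonalUnionOfEssentiallyPure M := by
  obtain ⟨V, hV, hΛV⟩ := hΛ.exists_isometry (Fintype.equivFin (n × Fin m)).symm
  have hdec : ∀ ρ : M, ∃ (φ : Fin m → ℂ) (σ : Matrix _ _ ℂ), star φ ⬝ᵥ φ = 1 ∧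
      Λ ρ = vecMulVec φ (star φ) ∧ IsDensity σ ∧ V * ρ.1 * Vᴴ = vecMulVec φ (star φ) ⊗ₖ σ := by
    rintro ⟨ρ, hρ⟩
    obtain ⟨φ, hφ, hΛφ⟩ := hpure ρ hρ
    obtain ⟨σ, hσ, hVσ⟩ := exists_eq_kronecker_of_partialTrace
      ((hM ρ hρ).1.mul_mul_conjTranspose_same V) hφ ((hΛV ρ).symm.trans hΛφ)
    exact ⟨φ, σ, hφ, hΛφ, hσ, hVσ⟩
  choose φ σ hφ hΛφ hσ hVσ using hdec
  refine ⟨Set.range fun ρ : M => {τ | ∃ h : τ ∈ M, σ ⟨τ, h⟩ = σ ρ}, ?_, ?_, ?_⟩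
  · ext τ
    constructor
    · exact fun hτ => ⟨_, ⟨⟨τ, hτ⟩, rfl⟩, hτ, rfl⟩
    · rintro ⟨_, ⟨ρ, rfl⟩, hτ, -⟩
      exact hτ
  · rintro _ ⟨ρ, rfl⟩
    -- A unit vector `φ ρ` exists, so the space is nonzero and a basis state for `ω` is available.
    have hm : 0 < m := by
      rcases Nat.eq_zero_or_pos m with rfl | hm
      · simpa using hφ ρ
      · exact hm
    -- The environment has dimension `card n * m`, so output times environment is `card n * (m *
    -- m)`.
    refine isEssentiallyPure_of_isometry (r := m * m) ?_ ⟨0, Nat.mul_pos hm hm⟩ hV (hσ ρ) ?_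
    · rw [Fintype.card_prod, Fintype.card_fin]; ring
    · rintro τ ⟨hτ, e⟩
      exact ⟨_, ⟨φ ⟨τ, hτ⟩, hφ _, rfl⟩, e ▸ hVσ ⟨τ, hτ⟩⟩
  · rintro _ ⟨ρ, rfl⟩ _ ⟨ρ', rfl⟩ hne τ ⟨hτ, e⟩ τ' ⟨hτ', e'⟩
    have hσne : σ ⟨τ, hτ⟩ ≠ σ ⟨τ', hτ'⟩ := by
      intro h
      refine hne ?_
      simp only [← e, ← e', h]
    refine mul_eq_zero_of_traceNorm_eq hV (hM τ hτ) (hM τ' hτ') (hφ ⟨τ, hτ⟩) (hφ ⟨τ', hτ'⟩)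
      (hσ ⟨τ, hτ⟩) (hσ ⟨τ', hτ'⟩) (hVσ ⟨τ, hτ⟩) (hVσ ⟨τ', hτ'⟩) ?_ hσne (fun h => hσne (by congr))
    have := hdist τ hτ τ' hτ'
    rw [traceDist_eq, traceDist_eq, hΛφ ⟨τ, hτ⟩, hΛφ ⟨τ', hτ'⟩] at this
    linarith

end Purification

end

theorem theorem2 {n : Type*} [Fintype n] [DecidableEq n]
    (M : Set (Matrix n n ℂ)) (hM : ∀ ρ ∈ M, Purification.IsDensity ρ) :
    List.TFAE
      [∃ (r : ℕ) (Λ : Matrix n n ℂ →ₗ[ℂ] Matrix (n × Fin r) (n × Fin r) ℂ),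
          Purification.IsPerfectPurifier M Λ,
        ∃ (m : ℕ) (Λ : Matrix n n ℂ →ₗ[ℂ] Matrix (Fin m) (Fin m) ℂ),
          Purification.IsCPTP Λ ∧
          (∀ ρ ∈ M, Purification.IsPure (Λ ρ)) ∧
          ∀ ρ ∈ M, ∀ ρ' ∈ M,
            Purification.traceDist (Λ ρ) (Λ ρ') = Purification.traceDist ρ ρ',
        Purification.IsOrthogonalUnionOfEssentiallyPure M] := by
  tfae_have 1 → 2 := fun h => Purification.HasPurifier.exists_traceDist_eq hM h
  tfae_have 2 → 3 := fun ⟨_, _, hΛ, hpure, hdist⟩ =>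
    Purification.isOrthogonalUnion_of_traceDist_eq hM hΛ hpure hdist
  tfae_have 3 → 1 := fun h => Purification.HasPurifier.of_orthogonalUnion hM h
  tfae_finish
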